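/- Let $G$ be an affine algebraic group over an algebraically closed field $\mathbb{K}$ and let $H$ be an observable subgroup of $G$, that is, a closed subgroup such that the homogeneous space $G/H$ of left cosets $gH$ is a quasi-affine variety. Here $G/H$ carries the quotient topology, a function on an open subset $U\subseteq G/H$ being regular if and only if its composition with the projection $p\colon G\to G/H$ is regular on $p^{-1}(U)$, and $p^*$ identifies the algebra $\mathbb{K}[G/H]$ of regular functions on $G/H$ with the algebra $\mathbb{K}[G]^{H_r}=\{f\in\mathbb{K}[G] \mid f(gh)=f(g)\ \text{for all } g\in G,\ h\in H\}$. Let $G/H\hookrightarrow X$ be any open embedding into a (not necessarily irreducible) affine variety $X$, let $I(X\setminus (G/H))\subseteq\mathbb{K}[X]$ be the ideal of regular functions on $X$ vanishing on $X\setminus (G/H)$, and let the boundary ideal $\mathcal{I}(G/H)$ be the radical of the ideal of $\mathbb{K}[G/H]=\mathbb{K}[G]^{H_r}$ generated by the restrictions to $G/H$ of the elements of $I(X\setminus (G/H))$. Then $G/H$ is affine if and only if $\mathcal{I}(G/H)=\mathbb{K}[G]^{H_r}$. -/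

import Mathlib

open Topology Filter

universe u v w

/-- The structure of a space with functions over the field `K` on a topological space `X`:
a sheaf of `K`-algebras of `K`-valued functions on `X`. The sheaf is given by its stalks:
`regularAt x` is the algebra of the functions that are regular at the point `x` (they are written
as total functions on `X`, but only their germs at `x` matter, by `congr`), and regularity at a
point is an open condition. The sections over an open set `U` are the functions
that are regular at every point of `U`. -/
class SpaceWithFunctions (K : Type u) (X : Type v) [Field K] [TopologicalSpace X] where
  /-- The functions regular at a given point. -/
  regularAt : X → Subalgebra K (X → K)
  congr : ∀ {x : X} {f g : X → K}, f =ᶠ[𝓝 x] g → f ∈ regularAt x → g ∈ regularAt x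
  eventually_regularAt : ∀ {x : X} {f : X → K}, f ∈ regularAt x → ∀ᶠ y in 𝓝 x, f ∈ regularAt y

/-- The algebra `K[X]` of the functions that are regular on the whole of `X`. -/
def regularFunctions (K : Type u) (X : Type v) [Field K] [TopologicalSpace X]
    [SpaceWithFunctions K X] : Subalgebra K (X → K) :=
  ⨅ x : X, SpaceWithFunctions.regularAt x

theorem mem_regularFunctions {K : Type u} {X : Type v} [Field K] [TopologicalSpace X]
    [SpaceWithFunctions K X] {f : X → K} :
    f ∈ regularFunctions K X ↔ ∀ x : X, f ∈ SpaceWithFunctions.regularAt (K := K) x := by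
  simp [regularFunctions, Algebra.mem_iInf]

/-- `X` is an affine variety (not necessarily irreducible): `K[X]` is a finitely generated algebra,
the points of `X` are the `K`-algebra homomorphisms `K[X] → K`, the topology is the
Zariski topology of `K[X]`, and the regular functions are locally the fractions of
elements of `K[X]`. -/
structure IsAffineVariety (K : Type u) (X : Type v) [Field K] [TopologicalSpace X]
    [SpaceWithFunctions K X] : Prop where
  fg : (regularFunctions K X).FG
  existsUnique_point : ∀ χ : regularFunctions K X →ₐ[K] K,
    ∃! x : X, ∀ f : regularFunctions K X, χ f = (f : X → K) x
  isClosed_iff : ∀ Z : Set X, IsClosed Z ↔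
    ∃ S : Set (regularFunctions K X), Z = {x | ∀ f ∈ S, (f : X → K) x = 0}
  mem_regularAt_iff : ∀ (x : X) (f : X → K), f ∈ SpaceWithFunctions.regularAt (K := K) x ↔
    ∃ a b : regularFunctions K X, (b : X → K) x ≠ 0 ∧
      ∀ᶠ y in 𝓝 x, f y = (a : X → K) y / (b : X → K) y

/-- `φ : X → Y` is an open embedding of spaces with functions, that is, an isomorphism of `X`
with an open subspace of `Y`. -/
structure IsOpenEmbeddingOfSpaces (K : Type u) {X : Type v} {Y : Type w} [Field K]
    [TopologicalSpace X] [SpaceWithFunctions K X] [TopologicalSpace Y] [SpaceWithFunctions K Y]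
    (φ : X → Y) : Prop where
  isOpenEmbedding : IsOpenEmbedding φ
  mem_regularAt_iff : ∀ (x : X) (f : Y → K),
    f ∈ SpaceWithFunctions.regularAt (K := K) (φ x) ↔
      f ∘ φ ∈ SpaceWithFunctions.regularAt (K := K) x

/-- `X` is quasi-affine: it is isomorphic to an open subspace of an affine variety. (Every affine
variety over `K` is isomorphic to a closed subset of some `Kⁿ`, so it is enough to
consider affine varieties in the universe of `K`.) -/
def IsQuasiAffineVariety (K : Type u) (X : Type v) [Field K] [TopologicalSpace X]
    [SpaceWithFunctions K X] : Prop :=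
  ∃ (Y : Type u) (_ : TopologicalSpace Y) (_ : SpaceWithFunctions K Y) (φ : X → Y),
    IsAffineVariety K Y ∧ IsOpenEmbeddingOfSpaces K φ

/-- The ideal `I(Z)` of `K[X]` of the regular functions that vanish on `Z ⊆ X`. -/
def vanishingIdealOf (K : Type u) {X : Type v} [Field K] [TopologicalSpace X]
    [SpaceWithFunctions K X] (Z : Set X) : Ideal (regularFunctions K X) where
  carrier := {f | ∀ x ∈ Z, (f : X → K) x = 0}
  add_mem' := by
    intro f g hf hg x hx
    simp [hf x hx, hg x hx]
  zero_mem' := by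
    intro x _
    rfl
  smul_mem' := by
    intro c f hf x hx
    simp [hf x hx]

/-- The restriction homomorphism `φ^* : K[Y] → K[X]`, `f ↦ f ∘ φ`, of an open embedding. -/
def IsOpenEmbeddingOfSpaces.pullback {K : Type u} {X : Type v} {Y : Type w} [Field K]
    [TopologicalSpace X] [SpaceWithFunctions K X] [TopologicalSpace Y] [SpaceWithFunctions K Y]
    {φ : X → Y} (hφ : IsOpenEmbeddingOfSpaces K φ) :
    regularFunctions K Y →ₐ[K] regularFunctions K X where
  toFun f := ⟨(f : Y → K) ∘ φ, mem_regularFunctions.2 fun x =>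
    (hφ.mem_regularAt_iff x f).1 (mem_regularFunctions.1 f.2 (φ x))⟩
  map_one' := rfl
  map_mul' _ _ := rfl
  map_zero' := rfl
  map_add' _ _ := rfl
  commutes' _ := rfl

/-- The boundary ideal of `X` computed in the open embedding `φ : X → Y`: the radical of the ideal
of `K[X]` generated by the (restrictions to `X` of the) elements of `I(Y ∖ φ(X)) ⊆ K[Y]`. -/
def IsOpenEmbeddingOfSpaces.boundaryIdeal {K : Type u} {X : Type v} {Y : Type w} [Field K]
    [TopologicalSpace X] [SpaceWithFunctions K X] [TopologicalSpace Y] [SpaceWithFunctions K Y]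
    {φ : X → Y} (hφ : IsOpenEmbeddingOfSpaces K φ) : Ideal (regularFunctions K X) :=
  ((vanishingIdealOf K (Set.range φ)ᶜ).map hφ.pullback).radical

/-- `G` is an affine algebraic group: an affine variety with a group structure whose
multiplication `G × G → G` and inversion `G → G` are morphisms. (The coordinate algebra of
`G × G` consists of the finite sums `(g, h) ↦ ∑ i, a i g * b i h` with `a i, b i ∈ K[G]`.) -/
structure IsAffineAlgebraicGroup (K : Type u) (G : Type v) [Field K] [Group G]
    [TopologicalSpace G] [SpaceWithFunctions K G] : Prop where
  isAffineVariety : IsAffineVariety K G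
  regular_mul : ∀ f : regularFunctions K G, ∃ (n : ℕ) (a b : Fin n → regularFunctions K G),
    ∀ g h : G, (f : G → K) (g * h) = ∑ i, (a i : G → K) g * (b i : G → K) h
  regular_inv : ∀ f ∈ regularFunctions K G, (fun g : G => f g⁻¹) ∈ regularFunctions K G

/-- The homogeneous space `G/H` of left cosets `gH` as a space with functions: the topology is the
quotient topology, and a function on an open set `U ⊆ G/H` is regular if and only if its
composition with the projection `p : G → G/H` is regular on `p⁻¹(U)`. -/
instance homogeneousSpace {K : Type u} {G : Type v} [Field K] [Group G] [TopologicalSpace G]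
    [SpaceWithFunctions K G] (H : Subgroup G) : SpaceWithFunctions K (G ⧸ H) where
  regularAt x :=
    { carrier := {f | ∀ᶠ y in 𝓝 x, ∀ g : G, (g : G ⧸ H) = y →
        (fun t : G => f (t : G ⧸ H)) ∈ SpaceWithFunctions.regularAt (K := K) g}
      mul_mem' := by
        intro f₁ f₂ h₁ h₂
        filter_upwards [h₁, h₂] with y hy₁ hy₂ g hg
        exact mul_mem (hy₁ g hg) (hy₂ g hg)
      add_mem' := by
        intro f₁ f₂ h₁ h₂
        filter_upwards [h₁, h₂] with y hy₁ hy₂ g hg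
        exact add_mem (hy₁ g hg) (hy₂ g hg)
      algebraMap_mem' := by
        intro c
        exact Eventually.of_forall fun y g _ => Subalgebra.algebraMap_mem _ c }
  congr := by
    intro x f₁ f₂ h h₁
    filter_upwards [h.eventually_nhds, h₁] with y hy hy₁ g hg
    refine SpaceWithFunctions.congr ?_ (hy₁ g hg)
    subst hg
    have hc : Continuous (fun t : G => (t : G ⧸ H)) := continuous_quotient_mk'
    exact hc.continuousAt.eventually hy
  eventually_regularAt := by
    intro x f hf
    exact Filter.Eventually.eventually_nhds hf

/-- The algebra `K[G]^{H_r}` of the regular functions on `G` that are invariant under all right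
translations `(h f)(g) = f (g h)` by elements of `H`. -/
def rightInvariants (K : Type u) {G : Type v} [Field K] [Group G] [TopologicalSpace G]
    [SpaceWithFunctions K G] (H : Subgroup G) : Subalgebra K (regularFunctions K G) where
  carrier := {f | ∀ h ∈ H, ∀ g : G, (f : G → K) (g * h) = (f : G → K) g}
  mul_mem' := by
    intro f₁ f₂ h₁ h₂ h hh g
    simp [h₁ h hh g, h₂ h hh g]
  add_mem' := by
    intro f₁ f₂ h₁ h₂ h hh g
    simp [h₁ h hh g, h₂ h hh g]
  algebraMap_mem' := by
    intro c h _ g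
    rfl

/-- The identification `p^* : K[G/H] ≃ K[G]^{H_r}`, `f ↦ f ∘ p`. -/
def invariantsEquiv (K : Type u) {G : Type v} [Field K] [Group G] [TopologicalSpace G]
    [SpaceWithFunctions K G] (H : Subgroup G) :
    regularFunctions K (G ⧸ H) ≃ₐ[K] rightInvariants K H where
  toFun f := ⟨⟨fun g : G => (f : G ⧸ H → K) (g : G ⧸ H), mem_regularFunctions.2 fun g =>
      (mem_regularFunctions.1 f.2 (g : G ⧸ H)).self_of_nhds g rfl⟩, by
    intro h hh g
    exact congrArg (f : G ⧸ H → K) (QuotientGroup.mk_mul_of_mem g hh)⟩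
  invFun F := ⟨fun x : G ⧸ H => Quotient.liftOn' x ((F : regularFunctions K G) : G → K) (by
      intro a b hab
      have h := F.2 _ (QuotientGroup.leftRel_apply.1 hab) a
      simpa using h.symm), mem_regularFunctions.2 fun _ =>
    Eventually.of_forall fun _ g _ => mem_regularFunctions.1 F.1.2 g⟩
  left_inv f := by
    apply Subtype.ext
    funext x
    induction x using QuotientGroup.induction_on with
    | H g => rfl
  right_inv _ := rfl
  map_mul' _ _ := rfl
  map_add' _ _ := rfl
  commutes' _ := rfl

/-- `H` is an observable subgroup of `G`: it is closed and `G/H` is quasi-affine. -/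
def IsObservable (K : Type u) {G : Type v} [Field K] [Group G] [TopologicalSpace G]
    [SpaceWithFunctions K G] (H : Subgroup G) : Prop :=
  IsClosed (H : Set G) ∧ IsQuasiAffineVariety K (G ⧸ H)

/-!
The result is an instance of an affineness criterion: for any open embedding `φ : X → Y` of a space
with functions `X` into an affine variety `Y`, the space `X` is affine if and only if
`I(Y ∖ φ(X))` generates the unit ideal of `K[X]`
(`IsOpenEmbeddingOfSpaces.isAffineVariety_iff`); passing to the radical and
transporting along `K[G/H] ≃ K[G]^{H_r}` does not affect whether an ideal is the whole ring.

If `X` is affine and `I(Y ∖ φ(X))` generates a proper ideal of `K[X]`, then by the Nullstellensatz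
all functions in `I(Y ∖ φ(X))` vanish at `φ x` for some point `x` of `X`. This is absurd, since
`Y ∖ φ(X)` is closed and hence is the set of common zeros of `I(Y ∖ φ(X))`.

Conversely, let `∑ cᵢ φ^*(fᵢ) = 1` with `fᵢ ∈ I(Y ∖ φ(X))` and `cᵢ ∈ K[X]`. The main tool is
`IsOpenEmbeddingOfSpaces.exists_pow_mul_eq_pullback`: for `f ∈ I(Y ∖ φ(X))` and `g ∈ K[X]`, some
product `φ^*(f)ⁿ g` is the restriction of a function of `K[Y]`. To see this, extend `g` by zero
to `Y`. The elements of `K[Y]` that multiply this extension into `K[Y]` form an ideal; the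
extension being locally a fraction, this ideal has no zeros in `φ(X)`, so that its radical
contains `f` by the Nullstellensatz. It follows that `K[X]` is generated by `φ^*(K[Y])` together
with the `cᵢ`, and that a character of `K[X]` is evaluation at the point of `Y` given by its
restriction to `K[Y]`, which lies in `φ(X)` because some `fᵢ` does not vanish there.
-/

/-- The denominators of `g` over the subalgebra `A`: the ideal of all `r ∈ A` with `r * g ∈ A`. -/
def denominatorIdeal {K B : Type*} [Field K] [CommRing B] [Algebra K B] (A : Subalgebra K B)
    (g : B) : Ideal A where
  carrier := {r | (r : B) * g ∈ A}
  add_mem' := by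
    intro r s hr hs
    simpa [add_mul] using add_mem hr hs
  zero_mem' := by simp
  smul_mem' := by
    intro c r hr
    simpa [mul_assoc] using mul_mem c.2 hr

theorem mem_denominatorIdeal {K B : Type*} [Field K] [CommRing B] [Algebra K B]
    {A : Subalgebra K B} {g : B} {r : A} : r ∈ denominatorIdeal A g ↔ (r : B) * g ∈ A :=
  Iff.rfl

/-- If every element of a family generating the unit ideal of `A` has a power that is a denominator
of `g` over `A`, then `g` lies in `A`. -/
theorem Subalgebra.mem_of_sum_mul_eq_one {K B ι : Type*} [Field K] [CommRing B] [Algebra K B]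
    {A : Subalgebra K B} {g : B} {s : Finset ι} {c f : ι → A} (hcf : ∑ i ∈ s, c i * f i = 1)
    (hf : ∀ i ∈ s, f i ∈ (denominatorIdeal A g).radical) : g ∈ A := by
  have h1 : (1 : A) ∈ (denominatorIdeal A g).radical := by
    rw [← hcf]
    exact sum_mem fun i hi => Ideal.mul_mem_left _ _ (hf i hi)
  have h2 : (1 : A) ∈ denominatorIdeal A g := by
    rwa [← Ideal.eq_top_iff_one, Ideal.radical_eq_top, Ideal.eq_top_iff_one] at h1
  simpa [mem_denominatorIdeal] using h2

/-- Zariski's lemma: over an algebraically closed field, every maximal ideal of a finitely generated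
algebra is the kernel of a character. -/
theorem Ideal.IsMaximal.exists_algHom_ker_eq {K A : Type*} [Field K] [IsAlgClosed K] [CommRing A]
    [Algebra K A] [Algebra.FiniteType K A] {m : Ideal A} (hm : m.IsMaximal) :
    ∃ χ : A →ₐ[K] K, ∀ a, χ a = 0 ↔ a ∈ m := by
  let _ : Field (A ⧸ m) := Ideal.Quotient.field m
  have : Algebra.FiniteType K (A ⧸ m) :=
    Algebra.FiniteType.of_surjective (Ideal.Quotient.mkₐ K m) (Ideal.Quotient.mkₐ_surjective K m)
  have : Module.Finite K (A ⧸ m) := finite_of_finite_type_of_isJacobsonRing K (A ⧸ m)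
  let χ : (A ⧸ m) →ₐ[K] K := IsAlgClosed.lift
  refine ⟨χ.comp (Ideal.Quotient.mkₐ K m), fun a => ?_⟩
  rw [← Ideal.Quotient.eq_zero_iff_mem]
  exact map_eq_zero_iff χ (RingHom.injective (χ : (A ⧸ m) →+* K))

section

variable {K : Type u} {X : Type v} {Y : Type w} [Field K] [TopologicalSpace X]
  [SpaceWithFunctions K X] [TopologicalSpace Y] [SpaceWithFunctions K Y]

/-! ### Affine varieties -/

theorem IsAffineVariety.finiteType (hY : IsAffineVariety K Y) :
    Algebra.FiniteType K (regularFunctions K Y) :=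
  (regularFunctions K Y).fg_iff_finiteType.1 hY.fg

/-- The Nullstellensatz for ideals: `I(V(J)) ⊆ √J`. -/
theorem IsAffineVariety.mem_radical [IsAlgClosed K] (hY : IsAffineVariety K Y)
    {J : Ideal (regularFunctions K Y)} {f : regularFunctions K Y}
    (hf : ∀ y : Y, (∀ e ∈ J, (e : Y → K) y = 0) → (f : Y → K) y = 0) : f ∈ J.radical := by
  have := hY.finiteType
  have : IsJacobsonRing (regularFunctions K Y) := isJacobsonRing_of_finiteType (A := K)
  rw [Ideal.radical_eq_jacobson, Ideal.jacobson, Ideal.mem_sInf]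
  rintro m ⟨hJm, hm⟩
  obtain ⟨χ, hχ⟩ := hm.exists_algHom_ker_eq (K := K)
  obtain ⟨y, hy, -⟩ := hY.existsUnique_point χ
  rw [← hχ, hy]
  exact hf y fun e he => by rw [← hy, hχ]; exact hJm he

/-- An ideal of `K[Y]` without zeros is the unit ideal. -/
theorem IsAffineVariety.eq_top [IsAlgClosed K] (hY : IsAffineVariety K Y)
    {J : Ideal (regularFunctions K Y)} (hJ : ∀ y : Y, ∃ e ∈ J, (e : Y → K) y ≠ 0) : J = ⊤ := by
  rw [← Ideal.radical_eq_top, Ideal.eq_top_iff_one]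
  refine hY.mem_radical fun y hy => ?_
  obtain ⟨e, he, hne⟩ := hJ y
  exact absurd (hy e he) hne

theorem IsAffineVariety.eq_of_forall_eq (hY : IsAffineVariety K Y) {y z : Y}
    (h : ∀ f : regularFunctions K Y, (f : Y → K) y = (f : Y → K) z) : y = z :=
  (hY.existsUnique_point ((Pi.evalAlgHom K (fun _ : Y => K) z).comp
    (regularFunctions K Y).val)).unique (fun f => (h f).symm) fun _ => rfl

theorem IsAffineVariety.isClosed_zeros (hY : IsAffineVariety K Y) (f : regularFunctions K Y) :
    IsClosed {y | (f : Y → K) y = 0} :=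
  (hY.isClosed_iff _).2 ⟨{f}, by simp⟩

/-- A point outside a closed set `Z` is separated from `Z` by a function of `I(Z)`. -/
theorem IsAffineVariety.exists_mem_vanishingIdealOf (hY : IsAffineVariety K Y) {Z : Set Y}
    (hZ : IsClosed Z) {y : Y} (hy : y ∉ Z) : ∃ f ∈ vanishingIdealOf K Z, (f : Y → K) y ≠ 0 := by
  obtain ⟨S, rfl⟩ := (hY.isClosed_iff Z).1 hZ
  simp only [Set.mem_ofPred_eq, not_forall] at hy
  obtain ⟨f, hf, hne⟩ := hy
  exact ⟨f, fun x hx => hx f hf, hne⟩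

/-- A function regular at a point has a denominator over `K[Y]` that does not vanish there. -/
theorem IsAffineVariety.exists_mem_denominatorIdeal (hY : IsAffineVariety K Y) {g : Y → K} {y : Y}
    (hg : g ∈ SpaceWithFunctions.regularAt (K := K) y) :
    ∃ e ∈ denominatorIdeal (regularFunctions K Y) g, (e : Y → K) y ≠ 0 := by
  obtain ⟨a, b, hb, hab⟩ := (hY.mem_regularAt_iff y g).1 hg
  obtain ⟨U, hU, hUo, hyU⟩ := eventually_nhds_iff.1 hab
  obtain ⟨c, hc, hcy⟩ := hY.exists_mem_vanishingIdealOf hUo.isClosed_compl (by simpa using hyU)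
  refine ⟨c * b * b, ?_, by simp [hb, hcy]⟩
  -- The identity `c b² g = c b a` holds on all of `Y`: outside `U` both sides contain the factor
  -- `c = 0`, and on the zeros of `b` both contain the factor `b = 0`.
  have key : ((c * b * b : regularFunctions K Y) : Y → K) * g
      = ((c * b * a : regularFunctions K Y) : Y → K) := by
    funext z
    by_cases hz : z ∈ U
    · by_cases hbz : (b : Y → K) z = 0
      · simp [hbz]
      · simp [hU z hz]
        field_simp
    · simp [hc z hz]
  rw [mem_denominatorIdeal, key]
  exact (c * b * a).2

/-! ### Open subspaces of affine varieties -/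

namespace IsOpenEmbeddingOfSpaces

variable {φ : X → Y}

theorem pullback_apply (hφ : IsOpenEmbeddingOfSpaces K φ) (f : regularFunctions K Y) (x : X) :
    (hφ.pullback f : X → K) x = (f : Y → K) (φ x) :=
  rfl

theorem extend_mem_regularAt (hφ : IsOpenEmbeddingOfSpaces K φ) {f : X → K} {x : X} :
    Function.extend φ f 0 ∈ SpaceWithFunctions.regularAt (K := K) (φ x) ↔
      f ∈ SpaceWithFunctions.regularAt (K := K) x := by
  rw [hφ.mem_regularAt_iff, Function.extend_comp hφ.isOpenEmbedding.injective]

/-- Regular functions on an open subspace are locally fractions of restricted functions. -/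
theorem mem_regularAt_iff_exists (hφ : IsOpenEmbeddingOfSpaces K φ) (hY : IsAffineVariety K Y)
    {f : X → K} {x : X} : f ∈ SpaceWithFunctions.regularAt (K := K) x ↔
      ∃ a b : regularFunctions K Y, (b : Y → K) (φ x) ≠ 0 ∧
        ∀ᶠ z in 𝓝 x, f z = (a : Y → K) (φ z) / (b : Y → K) (φ z) := by
  rw [← hφ.extend_mem_regularAt, hY.mem_regularAt_iff]
  refine exists_congr fun a => exists_congr fun b => and_congr_right fun _ => ?_
  rw [← hφ.isOpenEmbedding.map_nhds_eq, eventually_map]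
  simp only [hφ.isOpenEmbedding.injective.extend_apply]

theorem exists_pow_mul_eq_pullback [IsAlgClosed K] (hφ : IsOpenEmbeddingOfSpaces K φ)
    (hY : IsAffineVariety K Y) {f : regularFunctions K Y}
    (hf : f ∈ vanishingIdealOf K (Set.range φ)ᶜ) (g : regularFunctions K X) :
    ∃ (n : ℕ) (a : regularFunctions K Y), hφ.pullback f ^ n * g = hφ.pullback a := by
  have hrad : f ∈ (denominatorIdeal (regularFunctions K Y)
      (Function.extend φ (g : X → K) 0)).radical := by
    refine hY.mem_radical fun y hy => ?_
    by_cases hyφ : y ∈ Set.range φ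
    · obtain ⟨x, rfl⟩ := hyφ
      obtain ⟨e, he, hne⟩ := hY.exists_mem_denominatorIdeal
        (hφ.extend_mem_regularAt.2 (mem_regularFunctions.1 g.2 x))
      exact absurd (hy e he) hne
    · exact hf y hyφ
  obtain ⟨n, hn⟩ := hrad
  refine ⟨n, ⟨_, hn⟩, Subtype.ext (funext fun x => ?_)⟩
  simp [pullback_apply, hφ.isOpenEmbedding.injective.extend_apply]

theorem isClosed_zeros (hφ : IsOpenEmbeddingOfSpaces K φ) (hY : IsAffineVariety K Y)
    (f : regularFunctions K X) : IsClosed {x | (f : X → K) x = 0} := by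
  rw [← isOpen_compl_iff, isOpen_iff_mem_nhds]
  intro x hx
  obtain ⟨a, b, hb, hab⟩ := (hφ.mem_regularAt_iff_exists hY).1 (mem_regularFunctions.1 f.2 x)
  have ha : (a : Y → K) (φ x) ≠ 0 := by
    intro h0
    exact hx (by simp [hab.self_of_nhds, h0])
  have hopen (c : regularFunctions K Y) (hc : (c : Y → K) (φ x) ≠ 0) :
      ∀ᶠ z in 𝓝 x, (c : Y → K) (φ z) ≠ 0 :=
    hφ.isOpenEmbedding.continuous.continuousAt.eventually
      ((hY.isClosed_zeros c).isOpen_compl.mem_nhds hc)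
  filter_upwards [hab, hopen a ha, hopen b hb] with z hz haz hbz
  simp [hz, haz, hbz]

theorem isClosed_iff_exists (hφ : IsOpenEmbeddingOfSpaces K φ) (hY : IsAffineVariety K Y)
    (Z : Set X) : IsClosed Z ↔
      ∃ S : Set (regularFunctions K X), Z = {x | ∀ f ∈ S, (f : X → K) x = 0} := by
  constructor
  · intro hZ
    obtain ⟨Z', hZ', rfl⟩ := hφ.isOpenEmbedding.isInducing.isClosed_iff.1 hZ
    obtain ⟨S, rfl⟩ := (hY.isClosed_iff Z').1 hZ'
    exact ⟨hφ.pullback '' S, by ext x; simp only [Set.forall_mem_image]; rfl⟩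
  · rintro ⟨S, rfl⟩
    simp only [Set.ofPred_forall]
    exact isClosed_biInter fun f _ => hφ.isClosed_zeros hY f

theorem mem_regularAt_iff_exists_div (hφ : IsOpenEmbeddingOfSpaces K φ) (hY : IsAffineVariety K Y)
    (x : X) (f : X → K) : f ∈ SpaceWithFunctions.regularAt (K := K) x ↔
      ∃ a b : regularFunctions K X, (b : X → K) x ≠ 0 ∧
        ∀ᶠ z in 𝓝 x, f z = (a : X → K) z / (b : X → K) z := by
  constructor
  · intro hf
    obtain ⟨a, b, hb, hab⟩ := (hφ.mem_regularAt_iff_exists hY).1 hf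
    exact ⟨hφ.pullback a, hφ.pullback b, hb, hab⟩
  · rintro ⟨a, b, hb, hab⟩
    obtain ⟨a₁, a₂, ha₂, ha⟩ := (hφ.mem_regularAt_iff_exists hY).1 (mem_regularFunctions.1 a.2 x)
    obtain ⟨b₁, b₂, hb₂, hb'⟩ := (hφ.mem_regularAt_iff_exists hY).1 (mem_regularFunctions.1 b.2 x)
    have hb₁ : (b₁ : Y → K) (φ x) ≠ 0 := by
      intro h0
      exact hb (by simp [hb'.self_of_nhds, h0])
    refine (hφ.mem_regularAt_iff_exists hY).2 ⟨a₁ * b₂, a₂ * b₁, by simp [ha₂, hb₁], ?_⟩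
    filter_upwards [hab, ha, hb'] with z hz haz hbz
    simp [hz, haz, hbz, div_div_div_eq]

/-! ### The affineness criterion -/

/-- Membership of the unit in the ideal generated by `I(Y ∖ φ(X))`, written out. -/
theorem exists_sum_mul_pullback_eq_one (hφ : IsOpenEmbeddingOfSpaces K φ)
    (h : (vanishingIdealOf K (Set.range φ)ᶜ).map hφ.pullback = ⊤) :
    ∃ (n : ℕ) (c : Fin n → regularFunctions K X) (f : Fin n → regularFunctions K Y),
      (∀ i, f i ∈ vanishingIdealOf K (Set.range φ)ᶜ) ∧ ∑ i, c i * hφ.pullback (f i) = 1 := by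
  rw [Ideal.eq_top_iff_one, Ideal.map, Ideal.span, Submodule.mem_span_set'] at h
  obtain ⟨n, c, s, hs⟩ := h
  choose f hf hfs using fun i => (s i).2
  refine ⟨n, c, f, hf, ?_⟩
  rw [← hs]
  exact Finset.sum_congr rfl fun i _ => congrArg (c i * ·) (hfs i)

theorem finiteType_of_map_eq_top [IsAlgClosed K] (hφ : IsOpenEmbeddingOfSpaces K φ)
    (hY : IsAffineVariety K Y) (h : (vanishingIdealOf K (Set.range φ)ᶜ).map hφ.pullback = ⊤) :
    Algebra.FiniteType K (regularFunctions K X) := by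
  obtain ⟨n, c, f, hf, hcf⟩ := hφ.exists_sum_mul_pullback_eq_one h
  let A : Subalgebra K (regularFunctions K X) :=
    hφ.pullback.range ⊔ Algebra.adjoin K (Set.range c)
  have hrange (a : regularFunctions K Y) : hφ.pullback a ∈ A :=
    (le_sup_left : _ ≤ A) ⟨a, rfl⟩
  have hc (i : Fin n) : c i ∈ A :=
    (le_sup_right : _ ≤ A) (Algebra.subset_adjoin ⟨i, rfl⟩)
  have hA : A = ⊤ := by
    refine eq_top_iff.2 fun g _ => ?_
    refine Subalgebra.mem_of_sum_mul_eq_one (s := Finset.univ) (c := fun i => ⟨c i, hc i⟩)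
      (f := fun i => ⟨hφ.pullback (f i), hrange _⟩) (Subtype.ext (by simpa using hcf))
      fun i _ => ?_
    obtain ⟨k, a, hka⟩ := hφ.exists_pow_mul_eq_pullback hY (hf i) g
    refine ⟨k, mem_denominatorIdeal.2 ?_⟩
    simpa [hka] using hrange a
  refine ⟨hA ▸ Subalgebra.FG.sup ?_ (Subalgebra.fg_def.2 ⟨_, Set.finite_range c, rfl⟩)⟩
  rw [← Algebra.map_top]
  exact hY.finiteType.out.map _

theorem existsUnique_point_of_map_eq_top [IsAlgClosed K] (hφ : IsOpenEmbeddingOfSpaces K φ)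
    (hY : IsAffineVariety K Y) (h : (vanishingIdealOf K (Set.range φ)ᶜ).map hφ.pullback = ⊤)
    (χ : regularFunctions K X →ₐ[K] K) :
    ∃! x : X, ∀ f : regularFunctions K X, χ f = (f : X → K) x := by
  obtain ⟨y, hy, -⟩ := hY.existsUnique_point (χ.comp hφ.pullback)
  -- The ideal `ker χ` is proper, so it does not contain all of `I(Y ∖ φ(X))`.
  obtain ⟨f, hf, hfy⟩ : ∃ f ∈ vanishingIdealOf K (Set.range φ)ᶜ, (f : Y → K) y ≠ 0 := by
    by_contra! hcon
    have hle : (vanishingIdealOf K (Set.range φ)ᶜ).map hφ.pullback ≤ RingHom.ker χ :=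
      Ideal.map_le_iff_le_comap.2 fun f hf => (hy f).trans (hcon f hf)
    exact RingHom.ker_ne_top χ (top_le_iff.1 (h ▸ hle))
  obtain ⟨x, rfl⟩ : y ∈ Set.range φ := by
    by_contra hyφ
    exact hfy (hf y hyφ)
  refine ⟨x, fun g => ?_, fun z hz => ?_⟩
  · obtain ⟨n, a, hna⟩ := hφ.exists_pow_mul_eq_pullback hY hf g
    have h1 : (f : Y → K) (φ x) ^ n * χ g = (a : Y → K) (φ x) := by
      rw [← hy f, ← hy a, AlgHom.comp_apply, AlgHom.comp_apply, ← hna, map_mul, map_pow]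
    have h2 : (f : Y → K) (φ x) ^ n * (g : X → K) x = (a : Y → K) (φ x) :=
      congrFun (congrArg Subtype.val hna) x
    exact mul_left_cancel₀ (pow_ne_zero n hfy) (h1.trans h2.symm)
  · refine hφ.isOpenEmbedding.injective (hY.eq_of_forall_eq fun a => ?_)
    exact (hz (hφ.pullback a)).symm.trans (hy a)

/-- An open subspace `φ(X)` of an affine variety `Y` is affine if and only if `I(Y ∖ φ(X))`
generates the unit ideal of `K[X]`. -/
theorem isAffineVariety_iff [IsAlgClosed K] (hφ : IsOpenEmbeddingOfSpaces K φ)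
    (hY : IsAffineVariety K Y) :
    IsAffineVariety K X ↔ (vanishingIdealOf K (Set.range φ)ᶜ).map hφ.pullback = ⊤ := by
  constructor
  · intro hX
    refine hX.eq_top fun x => ?_
    obtain ⟨f, hf, hfx⟩ := hY.exists_mem_vanishingIdealOf
      (hφ.isOpenEmbedding.isOpen_range.isClosed_compl) (y := φ x) (by simp)
    exact ⟨hφ.pullback f, Ideal.mem_map_of_mem _ hf, hfx⟩
  · intro h
    exact {
      fg := (regularFunctions K X).fg_iff_finiteType.2 (hφ.finiteType_of_map_eq_top hY h)
      existsUnique_point := hφ.existsUnique_point_of_map_eq_top hY h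
      isClosed_iff := hφ.isClosed_iff_exists hY
      mem_regularAt_iff := hφ.mem_regularAt_iff_exists_div hY }

end IsOpenEmbeddingOfSpaces

end

/-- Let `G` be an affine algebraic group over an algebraically closed field `K` and `H` an
observable subgroup. The boundary ideal of `G/H`, computed in an arbitrary open embedding
`φ : G/H → Y` into an affine variety `Y` and carried over to `K[G]^{H_r}`, is the whole algebra
`K[G]^{H_r}` if and only if `G/H` is affine. -/
theorem mainTheorem3 {K : Type u} [Field K] [IsAlgClosed K] {G : Type v} [Group G]
    [TopologicalSpace G] [SpaceWithFunctions K G] (hG : IsAffineAlgebraicGroup K G)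
    (H : Subgroup G) (hH : IsObservable K H)
    {Y : Type w} [TopologicalSpace Y] [SpaceWithFunctions K Y] (hY : IsAffineVariety K Y)
    (φ : G ⧸ H → Y) (hφ : IsOpenEmbeddingOfSpaces K φ) :
    IsAffineVariety K (G ⧸ H) ↔
      hφ.boundaryIdeal.map (invariantsEquiv K H) = (⊤ : Ideal (rightInvariants K H)) := by
  rw [hφ.isAffineVariety_iff hY, ← Ideal.radical_eq_top]
  change hφ.boundaryIdeal = ⊤ ↔ _
  constructor
  · intro h
    rw [h, Ideal.map_top]
  · intro h
    have h' := congrArg (Ideal.comap (invariantsEquiv K H)) h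
    rwa [Ideal.comap_map_of_bijective _ (invariantsEquiv K H).bijective, Ideal.comap_top] at h'
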